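/- Let $N\ge1$, $\kappa=\frac{N\pi^2}{16-\pi^2}$, $\tau=\frac{16-\pi^2}{4\pi}$. Let $\rho>0$ (transmit SNR), $d>0$ (distance from base station to STAR-RIS), $\alpha\in\mathbb R$ (path-loss exponent), $p_r,p_t>0$ with $p_r+p_t=1$ (power allocation), $\beta_r,\beta_t>0$ (reflection/transmission amplitudes), and let $R_r,R_t$ be target rates. Let $h_n$, $g_{k,n}$ ($1\le n\le N$, $k\in\{r,t\}$) be the random amplitudes of the links from the base station to the $n$-th STAR-RIS element and from that element to user $k$, let $\theta_n$, $\zeta_{k,n}$ be their phases, and let $\varphi_{k,n}$ be the phase shifts of the surface. Assume ideal phase shifting, $\varphi_{k,n}=\theta_n+\zeta_{k,n}$, and assume that each equivalent gain $W_k=\left|\sum_{n=1}^N h_ng_{k,n}\right|^2$ is exactly Gamma distributed with density $\frac{w^{\kappa-1}e^{-w/\tau}}{\Gamma(\kappa)\tau^{\kappa}}$, $w>0$. For STAR-RIS distances $d_r,d_t>0$ of the reflecting and the transmitting user, put $V_k=\left|\sum_{n=1}^N h_ng_{k,n}e^{j(\varphi_{k,n}-\theta_n-\zeta_{k,n})}\right|^2$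 and let $$\gamma_r=\rho\,p_r\beta_r^2d^{-\alpha}d_r^{-\alpha}V_r,\qquad \gamma_t=\frac{\rho\,p_t\beta_t^2d^{-\alpha}d_t^{-\alpha}V_t}{\rho\,p_r\beta_t^2d^{-\alpha}d_t^{-\alpha}V_t+1},\qquad C_k(d_k)=\mathbb E[\log_2(1+\gamma_k)]$$ be the NOMA SNR/SINR and the ergodic rates (energy splitting). For $z>0$ let $$G(z)=G^{1,3}_{3,2}\!\left(z\,\Big|\,{1-\kappa,1,1\atop 1,0}\right)=\frac1{2\pi i}\int_{c-i\infty}^{c+i\infty}\frac{\Gamma(1-s)\,\Gamma(\kappa+s)\,\Gamma(s)^2}{\Gamma(1+s)}\,z^s\,ds,\qquad 0<c<1,$$ be the Meijer G-function; the integral converges absolutely and is real and independent of $c$. Then for all $d_r,d_t>0$ the expectations $C_r(d_r)$, $C_t(d_t)$ are finite and $$C_r(d_r)=\frac{1}{\Gamma(\kappa)\ln 2}\,G\!\left(\frac{\tau\rho p_r\beta_r^2}{d^\alpha d_r^\alpha}\right),$$ $$C_t(d_t)=\frac{1}{\Gamma(\kappa)\ln 2}\,G\!\left(\frac{\tau\rho\beta_t^2}{d^\alpha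 d_t^\alpha}\right)-\frac{1}{\Gamma(\kappa)\ln 2}\,G\!\left(\frac{\tau\rho p_r\beta_t^2}{d^\alpha d_t^\alpha}\right).$$ Consequently the coverage region $\{(d_t,d_r): d_t,d_r>0,\ C_t(d_t)>R_t,\ C_r(d_r)>R_r\}$ is the set of all $(d_t,d_r)$ with $d_t,d_r>0$ for which $R_t$ and $R_r$ are smaller than the right-hand sides of the formulas for $C_t(d_t)$ and $C_r(d_r)$, respectively; and the region including its boundary cases, $\{(d_t,d_r): d_t,d_r>0,\ R_t\le C_t(d_t),\ R_r\le C_r(d_r)\}$, is the set where $R_t$ and $R_r$ do not exceed these right-hand sides. -/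

import Mathlib

open MeasureTheory ProbabilityTheory

noncomputable section

/-! Meijer G-function -/

/-- The Mellin-Barnes integrand of the Meijer G-function `G^{m,n}_{p,q}(z | a; b)`:
`∏_{j ≤ m} Γ(b_j - s) ∏_{j ≤ n} Γ(1 - a_j + s) z^s`
divided by `∏_{m < j ≤ q} Γ(1 - b_j + s) ∏_{n < j ≤ p} Γ(a_j - s)`. -/
def meijerIntegrand (m n : ℕ) {p q : ℕ} (a : Fin p → ℂ) (b : Fin q → ℂ) (z s : ℂ) : ℂ :=
  (∏ j : Fin q, if (j : ℕ) < m then Complex.Gamma (b j - s)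
      else (Complex.Gamma (1 - b j + s))⁻¹) *
  (∏ j : Fin p, if (j : ℕ) < n then Complex.Gamma (1 - a j + s)
      else (Complex.Gamma (a j - s))⁻¹) *
  z ^ s

/-- The line `Re s = c` separates the poles of `Γ(b_j - s)`, `j ≤ m` (which lie to its right)
from the poles of `Γ(1 - a_j + s)`, `j ≤ n` (which lie to its left). -/
def MeijerSeparates (m n : ℕ) {p q : ℕ} (a : Fin p → ℂ) (b : Fin q → ℂ) (c : ℝ) : Prop :=
  (∀ j : Fin q, (j : ℕ) < m → c < (b j).re) ∧ (∀ j : Fin p, (j : ℕ) < n → (a j).re - 1 < c)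

/-- `g` is the value of `G^{m,n}_{p,q}(z | a; b)`: separating vertical lines exist, and for each of
them the Mellin-Barnes integral `(1 / 2πi) ∫ … ds` over the line (upwards) converges absolutely
and equals `g`; with `s = c + i t` it is `(1 / 2π) ∫ … dt`. -/
def IsMeijerG (m n : ℕ) {p q : ℕ} (a : Fin p → ℂ) (b : Fin q → ℂ) (z g : ℂ) : Prop :=
  (∃ c : ℝ, MeijerSeparates m n a b c) ∧
  ∀ c : ℝ, MeijerSeparates m n a b c →
    Integrable (fun t : ℝ => meijerIntegrand m n a b z (c + t * Complex.I)) ∧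
    (2 * (Real.pi : ℂ))⁻¹ * ∫ t : ℝ, meijerIntegrand m n a b z (c + t * Complex.I) = g

open Classical in
/-- The Meijer G-function, for parameters whose contour can be taken to be a vertical line
(and the value `0` otherwise). -/
def meijerG (m n : ℕ) {p q : ℕ} (a : Fin p → ℂ) (b : Fin q → ℂ) (z : ℂ) : ℂ :=
  if hg : ∃ g : ℂ, IsMeijerG m n a b z g then hg.choose else 0

/-- The (real value of the) function `z ↦ G^{1,3}_{3,2}(z | 1 - κ, 1, 1; 1, 0)` for real `z`. -/
def meijerG1332 (κ z : ℝ) : ℝ :=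
  (meijerG 1 3 ![1 - (κ : ℂ), 1, 1] ![1, 0] (z : ℂ)).re

/-! System model -/

/-- Shape parameter `κ = N π² / (16 - π²)`. -/
def gainShape (N : ℕ) : ℝ := N * Real.pi ^ 2 / (16 - Real.pi ^ 2)

/-- Scale parameter `τ = (16 - π²) / (4 π)`. -/
def gainScale : ℝ := (16 - Real.pi ^ 2) / (4 * Real.pi)

/-- Power gain `|∑ hₙ gₙ exp(j (φₙ - θₙ - ζₙ))|²` of the cascaded link through the surface:
`h`, `θ` are the amplitudes and phases of the links from the base station to the surface, `g`, `ζ`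
those of the links from the surface to the user, `φ` the phase shifts of the surface. -/
def cascadedGain {N : ℕ} (h g φ θ ζ : Fin N → ℝ) : ℝ :=
  ‖∑ n, ((h n * g n : ℝ) : ℂ) * Complex.exp (Complex.I * ((φ n - θ n - ζ n : ℝ) : ℂ))‖ ^ 2

/-- Equivalent channel gain `W = |∑ hₙ gₙ|²`. -/
def equivalentGain {N : ℕ} (h g : Fin N → ℝ) : ℝ := |∑ n, h n * g n| ^ 2

/-- SNR of the reflecting user after successive interference cancellation;
`w` is the power gain of its cascaded link. -/
def snrReflect (ρ α d pr βr dr w : ℝ) : ℝ :=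
  ρ * d ^ (-α) * dr ^ (-α) * (pr * βr ^ 2) * w

/-- SINR of the transmitting user, which treats the signal of the other user as noise;
`w` is the power gain of its cascaded link. -/
def sinrTransmit (ρ α d pr pt βt dt w : ℝ) : ℝ :=
  (ρ * (pt * βt ^ 2) * d ^ (-α) * dt ^ (-α) * w) /
    (ρ * (pr * βt ^ 2) * d ^ (-α) * dt ^ (-α) * w + 1)

/-- Ergodic rate `E[log₂(1 + γ)]`. -/
def ergodicRate {Ω : Type*} [MeasurableSpace Ω] (μ : Measure Ω) (γ : Ω → ℝ) : ℝ :=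
  ∫ ω, Real.logb 2 (1 + γ ω) ∂μ

/-- Coverage region: the pairs `(d_t, d_r)` of distances at which the ergodic rates
`C_t(d_t)`, `C_r(d_r)` exceed the target rates. -/
def coverageRegion (Ct Cr : ℝ → ℝ) (Rt Rr : ℝ) : Set (ℝ × ℝ) :=
  {x | 0 < x.1 ∧ 0 < x.2 ∧ Ct x.1 > Rt ∧ Cr x.2 > Rr}

/-- Coverage region with its boundary: the target rates do not exceed the ergodic rates. -/
def closedCoverageRegion (Ct Cr : ℝ → ℝ) (Rt Rr : ℝ) : Set (ℝ × ℝ) :=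
  {x | 0 < x.1 ∧ 0 < x.2 ∧ Rt ≤ Ct x.1 ∧ Rr ≤ Cr x.2}

/-- Closed form for the reflecting user. -/
def reflectBound (κ τ ρ α d pr βr dr : ℝ) : ℝ :=
  1 / (Real.Gamma κ * Real.log 2) *
    meijerG1332 κ (τ * ρ * pr * βr ^ 2 / (d ^ α * dr ^ α))

/-- Closed form for the transmitting user. -/
def transmitBound (κ τ ρ α d pr βt dt : ℝ) : ℝ :=
  1 / (Real.Gamma κ * Real.log 2) *
      meijerG1332 κ (τ * ρ * βt ^ 2 / (d ^ α * dt ^ α)) -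
    1 / (Real.Gamma κ * Real.log 2) *
      meijerG1332 κ (τ * ρ * pr * βt ^ 2 / (d ^ α * dt ^ α))

end

/-! Ideal phases turn each cascaded gain into the Gamma-distributed `W`. Since `pt + pr = 1`, `1 +
γ_t` is a quotient of two factors `1 + A W`, so both rates reduce to `E[log (1 + A W)]`, and scaling
out `τ` leaves `logGammaIntegral κ (τ A)`.

To identify this integral with the G-function, write `log (1 + z x)` as a Mellin-Barnes integral of
`(z x)^s Γ(s) Γ(1 - s) / s` over `0 < Re s = c < 1` and exchange it with the integral over `x`.
Euler's integral then produces `Γ(κ + s)`, and `Γ(s) / s = Γ(s)² / Γ(1 + s)` gives the Meijer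
integrand (`isMeijerG_logGammaIntegral`).

The Mellin-Barnes formula is Mellin inversion. The transform of `log (1 + 1/u)` comes from two
applications of `hasMellin_integral`, to `1/(u + v) = ∫₀^∞ e^(-t(u + v)) dt` and to `log (1 + 1/u) =
∫₀¹ dv/(u + v)`. -/

noncomputable section

/-! ### Mellin transforms -/

/-- Fubini for Mellin transforms: the Mellin transform of `u ↦ ∫ F u t ∂ν` is the integral of the
Mellin transforms of the nonnegative functions `F · t`. -/
theorem hasMellin_integral {T : Type*} [MeasurableSpace T] {ν : Measure T} [SFinite ν]
    {F : ℝ → T → ℝ} (hF : Measurable (Function.uncurry F))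
    (hF0 : ∀ᵐ t ∂ν, ∀ u, 0 < u → 0 ≤ F u t) {s : ℂ} {m m' : T → ℂ}
    (hm : ∀ᵐ t ∂ν, HasMellin (fun u => (F u t : ℂ)) s (m t))
    (hm' : ∀ᵐ t ∂ν, HasMellin (fun u => (F u t : ℂ)) (s.re : ℂ) (m' t))
    (hint : Integrable m' ν) :
    HasMellin (fun u => ((∫ t, F u t ∂ν : ℝ) : ℂ)) s (∫ t, m t ∂ν) := by
  set H : ℝ × T → ℂ := fun p => (p.1 : ℂ) ^ (s - 1) * (F p.1 p.2 : ℂ) with hH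
  have hmeas : Measurable H := by
    have h1 : Measurable fun p : ℝ × T => (p.1 : ℂ) :=
      Complex.measurable_ofReal.comp measurable_fst
    exact (h1.pow_const _).mul (Complex.measurable_ofReal.comp hF)
  have hI : Integrable H ((volume.restrict (Set.Ioi (0 : ℝ))).prod ν) := by
    rw [integrable_prod_iff' hmeas.aestronglyMeasurable]
    refine ⟨?_, ?_⟩
    · filter_upwards [hm] with t ht
      simpa [MellinConvergent, IntegrableOn, smul_eq_mul] using ht.1
    · refine hint.norm.congr ?_
      filter_upwards [hm', hF0] with t ht h0
      -- As `F` is nonnegative, the L¹ norm of `H (·, t)` is the Mellin transform at the real point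
      -- `s.re`; integrability of `m'` is thus the Fubini condition.
      have e : m' t = ((∫ u in Set.Ioi (0 : ℝ), ‖H (u, t)‖ : ℝ) : ℂ) := by
        rw [← ht.2, mellin, ← integral_complex_ofReal]
        refine setIntegral_congr_fun measurableSet_Ioi fun u hu => ?_
        simp only [hH, norm_mul, Complex.norm_cpow_eq_rpow_re_of_pos hu, Complex.norm_real,
          Real.norm_of_nonneg (h0 u hu), smul_eq_mul, Complex.ofReal_mul]
        rw [Complex.ofReal_cpow (le_of_lt hu)]
        simp
      rw [e, Complex.norm_real, Real.norm_of_nonneg (integral_nonneg fun _ => norm_nonneg _)]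
  have hin : ∀ u : ℝ, ∫ t, H (u, t) ∂ν = (u : ℂ) ^ (s - 1) • ((∫ t, F u t ∂ν : ℝ) : ℂ) := by
    intro u
    simp only [hH]
    rw [integral_const_mul, smul_eq_mul, integral_complex_ofReal]
  constructor
  · simpa only [MellinConvergent, IntegrableOn, hin] using hI.integral_prod_left
  · rw [mellin]
    simp only [← hin]
    rw [integral_integral_swap hI]
    refine integral_congr_ae ?_
    filter_upwards [hm] with t ht
    rw [← ht.2, mellin]
    simp only [hH, smul_eq_mul]

theorem HasMellin.congr_Ioi {f g : ℝ → ℂ} {s m : ℂ} (hf : HasMellin f s m)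
    (h : ∀ u : ℝ, 0 < u → f u = g u) : HasMellin g s m := by
  have h' : Set.EqOn (fun t : ℝ => (t : ℂ) ^ (s - 1) • f t) (fun t : ℝ => (t : ℂ) ^ (s - 1) • g t)
      (Set.Ioi 0) := fun u hu => by simp only [h u hu]
  exact ⟨(integrableOn_congr_fun h' measurableSet_Ioi).1 hf.1,
    (setIntegral_congr_fun measurableSet_Ioi h').symm.trans hf.2⟩

theorem hasMellin_exp_neg_mul {r : ℝ} (hr : 0 < r) {s : ℂ} (hs : 0 < s.re) :
    HasMellin (fun u => ((Real.exp (-(r * u)) : ℝ) : ℂ)) s ((1 / (r : ℂ)) ^ s * Complex.Gamma s) := by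
  have h1 : MellinConvergent (fun u : ℝ => ((Real.exp (-u) : ℝ) : ℂ)) s := by
    have := Complex.GammaIntegral_convergent hs
    simpa [MellinConvergent, mul_comm] using this
  refine ⟨?_, ?_⟩
  · exact (MellinConvergent.comp_mul_left (f := fun u : ℝ => ((Real.exp (-u) : ℝ) : ℂ)) hr).2 h1
  · rw [← Complex.integral_cpow_mul_exp_neg_mul_Ioi hs (by simpa using hr)]
    simp [mellin]

/-- Mellin transform of `u ↦ 1 / (u + v)`. -/
theorem hasMellin_inv_add {v : ℝ} (hv : 0 < v) {s : ℂ} (hs0 : 0 < s.re) (hs1 : s.re < 1) :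
    HasMellin (fun u => (((u + v)⁻¹ : ℝ) : ℂ)) s
      ((v : ℂ) ^ (s - 1) * (Complex.Gamma s * Complex.Gamma (1 - s))) := by
  have key : ∀ w : ℂ, 0 < w.re → w.re < 1 →
      HasMellin (fun t => ((Real.exp (-(v * t)) : ℝ) : ℂ)) (1 - w)
        ((1 / (v : ℂ)) ^ (1 - w) * Complex.Gamma (1 - w)) := fun w _ h1 =>
    hasMellin_exp_neg_mul hv (by simpa using h1)
  -- The Mellin transform of `u ↦ e^(-t(u + v))` is `Γ(w) t^(-w) e^(-vt)`. With exponent `1 - w - 1`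
  -- it is, up to `Γ(w)`, the integrand of a Mellin transform at `1 - w`, whence the factor `Γ(1 -
  -- w)`.
  set m : ℂ → ℝ → ℂ := fun w t =>
    Complex.Gamma w * ((t : ℂ) ^ (1 - w - 1) • ((Real.exp (-(v * t)) : ℝ) : ℂ)) with hmdef
  have hm : ∀ w : ℂ, 0 < w.re → ∀ t : ℝ, 0 < t →
      HasMellin (fun u => ((Real.exp (-(t * (u + v))) : ℝ) : ℂ)) w (m w t) := by
    intro w h0 t ht
    have h := hasMellin_const_smul (hasMellin_exp_neg_mul ht h0).1 (((Real.exp (-(v * t)) : ℝ) : ℂ))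
    rw [(hasMellin_exp_neg_mul ht h0).2] at h
    have e2 : m w t = ((Real.exp (-(v * t)) : ℝ) : ℂ) • ((1 / (t : ℂ)) ^ w * Complex.Gamma w) := by
      have : (1 / (t : ℂ)) ^ w = (t : ℂ) ^ (1 - w - 1) := by
        rw [one_div, Complex.inv_cpow _ _ (by
          rw [Complex.arg_ofReal_of_nonneg ht.le]; exact Real.pi_pos.ne), ← Complex.cpow_neg]
        congr 1; ring
      simp only [hmdef, smul_eq_mul, this]; ring
    rw [e2]
    refine h.congr_Ioi fun u _ => ?_
    simp only [smul_eq_mul]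
    rw [← Complex.ofReal_mul, ← Real.exp_add]
    congr 2; ring
  have hH := hasMellin_integral (ν := volume.restrict (Set.Ioi (0 : ℝ)))
    (F := fun u t => Real.exp (-(t * (u + v)))) (s := s) (m := m s) (m' := m s.re)
    (by unfold Function.uncurry; fun_prop)
    (Filter.Eventually.of_forall fun t u _ => (Real.exp_pos _).le)
    ((ae_restrict_iff' measurableSet_Ioi).2 (Filter.Eventually.of_forall fun t ht => hm s hs0 t ht))
    ((ae_restrict_iff' measurableSet_Ioi).2
      (Filter.Eventually.of_forall fun t ht => hm s.re (by simpa using hs0) t ht))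
    ((key s.re (by simpa using hs0) (by simpa using hs1)).1.const_mul _)
  have e3 : ∫ t in Set.Ioi (0 : ℝ), m s t =
      (v : ℂ) ^ (s - 1) * (Complex.Gamma s * Complex.Gamma (1 - s)) := by
    have h := (key s hs0 hs1).2
    rw [mellin] at h
    simp only [hmdef]
    rw [integral_const_mul, h, one_div, Complex.inv_cpow _ _ (by
      rw [Complex.arg_ofReal_of_nonneg hv.le]; exact Real.pi_pos.ne), ← Complex.cpow_neg]
    rw [neg_sub]; ring
  rw [e3] at hH
  refine hH.congr_Ioi fun u hu => ?_
  have huv : 0 < u + v := by positivity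
  congr 1
  have := integral_exp_mul_Ioi (a := -(u + v)) (by linarith) 0
  simp only [mul_zero, Real.exp_zero] at this
  rw [show (fun t : ℝ => Real.exp (-(t * (u + v)))) = fun t => Real.exp (-(u + v) * t) by
    ext t; congr 1; ring, this]
  field_simp

/-- Mellin transform of `u ↦ log (1 + 1 / u)`. -/
theorem hasMellin_log_one_add_inv {s : ℂ} (hs0 : 0 < s.re) (hs1 : s.re < 1) :
    HasMellin (fun u => ((Real.log (1 + u⁻¹) : ℝ) : ℂ)) s
      (Complex.Gamma s * Complex.Gamma (1 - s) / s) := by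
  have hI : ∀ w : ℂ, 0 < w.re →
      IntegrableOn (fun v : ℝ => (v : ℂ) ^ (w - 1)) (Set.Ioc (0 : ℝ) 1) := fun w hw => by
    rw [← intervalIntegrable_iff_integrableOn_Ioc_of_le zero_le_one]
    exact intervalIntegral.intervalIntegrable_cpow' (by simpa using hw)
  have hH := hasMellin_integral (ν := volume.restrict (Set.Ioc (0 : ℝ) 1))
    (F := fun u v => (u + v)⁻¹) (s := s)
    (m := fun v => (v : ℂ) ^ (s - 1) * (Complex.Gamma s * Complex.Gamma (1 - s)))
    (m' := fun v => (v : ℂ) ^ ((s.re : ℂ) - 1) *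
      (Complex.Gamma s.re * Complex.Gamma (1 - s.re)))
    (by unfold Function.uncurry; fun_prop)
    ((ae_restrict_iff' measurableSet_Ioc).2 (Filter.Eventually.of_forall fun v hv u hu =>
      inv_nonneg.2 (add_pos hu hv.1).le))
    ((ae_restrict_iff' measurableSet_Ioc).2 (Filter.Eventually.of_forall fun v hv =>
      hasMellin_inv_add hv.1 hs0 hs1))
    ((ae_restrict_iff' measurableSet_Ioc).2 (Filter.Eventually.of_forall fun v hv =>
      hasMellin_inv_add hv.1 (by simpa using hs0) (by simpa using hs1)))
    ((hI s.re (by simpa using hs0)).mul_const _)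
  have hsne : s ≠ 0 := fun h => by simp [h] at hs0
  have e : ∫ v in Set.Ioc (0 : ℝ) 1,
      (v : ℂ) ^ (s - 1) * (Complex.Gamma s * Complex.Gamma (1 - s)) =
      Complex.Gamma s * Complex.Gamma (1 - s) / s := by
    rw [integral_mul_const, ← intervalIntegral.integral_of_le zero_le_one,
      integral_cpow (Or.inl (by simpa using hs0))]
    simp [Complex.zero_cpow hsne]
    ring
  rw [e] at hH
  refine hH.congr_Ioi fun u hu => ?_
  congr 1
  rw [← intervalIntegral.integral_of_le zero_le_one,
    intervalIntegral.integral_comp_add_left (fun x => x⁻¹) u, add_zero,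
    integral_inv_of_pos hu (by linarith)]
  congr 1; field_simp

/-! ### Mellin inversion for the logarithm -/

theorem norm_sq_sin_pi_mul (c t : ℝ) :
    ‖Complex.sin (Real.pi * (c + t * Complex.I))‖ ^ 2 =
      Real.sin (Real.pi * c) ^ 2 + Real.sinh (Real.pi * t) ^ 2 := by
  have : (Real.pi : ℂ) * (c + t * Complex.I) =
      ((Real.pi * c : ℝ) : ℂ) + ((Real.pi * t : ℝ) : ℂ) * Complex.I := by push_cast; ring
  rw [this, Complex.sin_add_mul_I, ← Complex.ofReal_sin, ← Complex.ofReal_cos,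
    ← Complex.ofReal_sinh, ← Complex.ofReal_cosh, ← Complex.ofReal_mul, ← Complex.ofReal_mul,
    Complex.sq_norm, Complex.normSq_add_mul_I]
  have h1 := Real.sin_sq_add_cos_sq (Real.pi * c)
  have h2 := Real.cosh_sq (Real.pi * t)
  rw [mul_pow, mul_pow, h2]
  linear_combination Real.sinh (Real.pi * t) ^ 2 * h1

/-- The Mellin transform of `log (1 + 1 / u)` is absolutely integrable along vertical lines in the
strip `0 < Re s < 1`. -/
theorem verticalIntegrable_Gamma_mul_Gamma_div {c : ℝ} (hc0 : 0 < c) (hc1 : c < 1) :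
    Complex.VerticalIntegrable (fun s => Complex.Gamma s * Complex.Gamma (1 - s) / s) c := by
  unfold Complex.VerticalIntegrable
  simp only [Complex.Gamma_mul_Gamma_one_sub]
  set q := Real.sin (Real.pi * c)
  have hq : 0 < q := Real.sin_pos_of_pos_of_lt_pi (by positivity) (by
    nlinarith [Real.pi_pos])
  -- By the reflection formula the function is `π / (s sin (π s))`. This `k` makes `k² (1 + t²)` a
  -- lower bound of both `|s|²` and `|sin (π s)|²`, so the quotient is `O(1 / (1 + t²))`.
  set k := min c q
  have hk : 0 < k := lt_min hc0 hq
  have hk1 : k ^ 2 ≤ 1 := pow_le_one₀ hk.le ((min_le_left _ _).trans hc1.le)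
  refine Integrable.mono' (g := fun t : ℝ => Real.pi / k ^ 2 * (1 + t ^ 2)⁻¹)
    (integrable_inv_one_add_sq.const_mul _) (Measurable.aestronglyMeasurable (by fun_prop)) ?_
  refine Filter.Eventually.of_forall fun t => ?_
  rw [norm_div, norm_div, Complex.norm_real, Real.norm_of_nonneg Real.pi_pos.le]
  have a1 : k ^ 2 * (1 + t ^ 2) ≤ ‖(c : ℂ) + t * Complex.I‖ ^ 2 := by
    rw [Complex.sq_norm, Complex.normSq_add_mul_I]
    have : k ^ 2 ≤ c ^ 2 := pow_le_pow_left₀ hk.le (min_le_left _ _) 2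
    nlinarith [mul_le_mul_of_nonneg_right hk1 (sq_nonneg t)]
  have a2 : k ^ 2 * (1 + t ^ 2) ≤ ‖Complex.sin (Real.pi * (c + t * Complex.I))‖ ^ 2 := by
    rw [norm_sq_sin_pi_mul]
    have h1 : k ^ 2 ≤ q ^ 2 := pow_le_pow_left₀ hk.le (min_le_right _ _) 2
    have h2 : t ^ 2 ≤ Real.sinh (Real.pi * t) ^ 2 := by
      rw [sq_le_sq, Real.abs_sinh]
      refine le_trans ?_ (Real.self_le_sinh_iff.2 (abs_nonneg _))
      rw [abs_mul, abs_of_pos Real.pi_pos]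
      nlinarith [abs_nonneg t, Real.pi_gt_three]
    change _ ≤ q ^ 2 + _
    nlinarith [mul_le_mul_of_nonneg_right hk1 (sq_nonneg t)]
  have hp : 0 < k ^ 2 * (1 + t ^ 2) := by positivity
  have a3 : k ^ 2 * (1 + t ^ 2) ≤
      ‖Complex.sin (Real.pi * (c + t * Complex.I))‖ * ‖(c : ℂ) + t * Complex.I‖ := by
    refine (pow_le_pow_iff_left₀ hp.le (by positivity) two_ne_zero).1 ?_
    rw [mul_pow ‖_‖, sq (k ^ 2 * (1 + t ^ 2))]
    exact mul_le_mul a2 a1 hp.le (by positivity)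
  rw [div_div]
  calc _ ≤ Real.pi / (k ^ 2 * (1 + t ^ 2)) := by gcongr
    _ = _ := by rw [div_mul_eq_div_div, div_eq_mul_inv _ (1 + t ^ 2)]

/-- Mellin-Barnes representation of `log (1 + u)`. -/
theorem log_one_add_eq_integral_verticalLine {c : ℝ} (hc0 : 0 < c) (hc1 : c < 1) {u : ℝ}
    (hu : 0 < u) :
    ((Real.log (1 + u) : ℝ) : ℂ) = (2 * (Real.pi : ℂ))⁻¹ * ∫ t : ℝ,
      (u : ℂ) ^ ((c : ℂ) + t * Complex.I) *
        (Complex.Gamma (c + t * Complex.I) * Complex.Gamma (1 - (c + t * Complex.I)) /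
          (c + t * Complex.I)) := by
  have hre : ∀ t : ℝ, ((c : ℂ) + t * Complex.I).re = c := fun t => by simp
  have hmel : ∀ t : ℝ, mellin (fun u : ℝ => ((Real.log (1 + u⁻¹) : ℝ) : ℂ)) (c + t * Complex.I) =
      Complex.Gamma (c + t * Complex.I) * Complex.Gamma (1 - (c + t * Complex.I)) /
        (c + t * Complex.I) := fun t =>
    (hasMellin_log_one_add_inv (by rwa [hre]) (by rwa [hre])).2
  -- Inversion is applied to `log (1 + 1/u)` at `u⁻¹`: the transform of `log (1 + u)` itself lives
  -- on `-1 < Re s < 0`, and the reciprocal moves it to the strip of the contour.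
  have h := mellinInv_mellin_eq c (fun u : ℝ => ((Real.log (1 + u⁻¹) : ℝ) : ℂ)) (inv_pos.2 hu)
    (hasMellin_log_one_add_inv (by simpa using hc0) (by simpa using hc1)).1
    (by
      have := verticalIntegrable_Gamma_mul_Gamma_div hc0 hc1
      unfold Complex.VerticalIntegrable at this ⊢
      simpa only [hmel] using this)
    (by
      refine Complex.continuous_ofReal.continuousAt.comp ?_
      refine ContinuousAt.log ?_ (by positivity)
      exact continuousAt_const.add (continuousAt_inv₀ (by positivity)))
  rw [inv_inv] at h
  rw [← h, mellinInv]
  simp only [hmel, smul_eq_mul]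
  rw [Complex.real_smul]
  push_cast
  rw [one_div]
  congr 2
  ext t
  congr 1
  rw [Complex.inv_cpow _ _ (by
    rw [Complex.arg_ofReal_of_nonneg hu.le]; exact Real.pi_pos.ne), ← Complex.cpow_neg, neg_neg]

/-! ### The Meijer G-function as a Gamma-weighted logarithmic integral -/

/-- The integral `∫₀^∞ log (1 + z x) x^(κ - 1) e^(-x) dx`. -/
def logGammaIntegral (κ z : ℝ) : ℝ :=
  ∫ x in Set.Ioi (0 : ℝ), Real.log (1 + z * x) * (x ^ (κ - 1) * Real.exp (-x))

theorem meijerIntegrand_eq {κ : ℝ} {z s : ℂ} (hs : s ≠ 0) :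
    meijerIntegrand 1 3 ![1 - (κ : ℂ), 1, 1] ![1, 0] z s =
      Complex.Gamma (κ + s) * z ^ s * (Complex.Gamma s * Complex.Gamma (1 - s) / s) := by
  unfold meijerIntegrand
  rw [Fin.prod_univ_two, Fin.prod_univ_three]
  simp only [Matrix.cons_val]
  simp only [Fin.val_zero, Fin.val_one, Fin.val_two]
  norm_num
  rw [add_comm 1 s, Complex.Gamma_add_one s hs]
  -- `Γ(1 + s) = s Γ(s)` cancels one factor `Γ(s)`. Where `Complex.Gamma` takes its default value
  -- `0` at a pole, both sides vanish.
  by_cases hg : Complex.Gamma s = 0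
  · simp [hg]
  · field_simp

/-- The poles of `Γ(1 - s)` and `Γ(s)` bound the strip; the condition `-κ < c` from `Γ(κ + s)` is
implied because `κ > 0`. -/
theorem meijerSeparates_iff {κ : ℝ} (hκ : 0 < κ) (c : ℝ) :
    MeijerSeparates 1 3 ![1 - (κ : ℂ), 1, 1] ![1, 0] c ↔ 0 < c ∧ c < 1 := by
  unfold MeijerSeparates
  rw [Fin.forall_fin_two, Fin.forall_fin_succ, Fin.forall_fin_two]
  simp
  constructor
  · rintro ⟨h1, -, h2⟩; exact ⟨h2, h1⟩
  · rintro ⟨h1, h2⟩; exact ⟨h2, by linarith, h1⟩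

theorem IsMeijerG.unique {m n p q : ℕ} {a : Fin p → ℂ} {b : Fin q → ℂ} {z g g' : ℂ}
    (h : IsMeijerG m n a b z g) (h' : IsMeijerG m n a b z g') : g = g' := by
  obtain ⟨c, hc⟩ := h.1
  rw [← (h.2 c hc).2, ← (h'.2 c hc).2]

theorem IsMeijerG.meijerG_eq {m n p q : ℕ} {a : Fin p → ℂ} {b : Fin q → ℂ} {z g : ℂ}
    (h : IsMeijerG m n a b z g) : meijerG m n a b z = g := by
  have hex : ∃ g : ℂ, IsMeijerG m n a b z g := ⟨g, h⟩
  rw [meijerG, dif_pos hex]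
  exact hex.choose_spec.unique h

/-- Evaluation of the Mellin-Barnes integral by exchanging it with Euler's integral for
`Γ(κ + s)`. -/
theorem isMeijerG_logGammaIntegral {κ z : ℝ} (hκ : 0 < κ) (hz : 0 < z) :
    IsMeijerG 1 3 ![1 - (κ : ℂ), 1, 1] ![1, 0] (z : ℂ) (logGammaIntegral κ z : ℂ) := by
  refine ⟨⟨1 / 2, (meijerSeparates_iff hκ _).2 (by norm_num)⟩, fun c hc => ?_⟩
  obtain ⟨hc0, hc1⟩ := (meijerSeparates_iff hκ c).1 hc
  have hne : ∀ t : ℝ, (c : ℂ) + t * Complex.I ≠ 0 := fun t h => by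
    have := congrArg Complex.re h
    simp at this; exact hc0.ne' this
  simp only [meijerIntegrand_eq (hne _)]
  set M : ℝ → ℂ := fun t => Complex.Gamma (c + t * Complex.I) *
    Complex.Gamma (1 - (c + t * Complex.I)) / (c + t * Complex.I) with hMdef
  have hM : Integrable M := verticalIntegrable_Gamma_mul_Gamma_div hc0 hc1
  set H : ℝ × ℝ → ℂ := fun p =>
    (((z * p.2 : ℝ) : ℂ) ^ ((c : ℂ) + p.1 * Complex.I) * M p.1) *
      ((p.2 ^ (κ - 1) * Real.exp (-p.2) : ℝ) : ℂ) with hHdef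
  have hG : ∀ a : ℝ, 0 < a →
      IntegrableOn (fun x : ℝ => x ^ (a - 1) * Real.exp (-x)) (Set.Ioi 0) := fun a ha => by
    simpa only [mul_comm] using Real.GammaIntegral_convergent ha
  have hH : Integrable H (volume.prod (volume.restrict (Set.Ioi (0 : ℝ)))) := by
    -- On the line `|(z x)^s| = (z x)^c`, so `‖H‖` factors as `z^c ‖M t‖` times the integrand of
    -- `Γ(κ + c)`.
    have hprod := (hM.norm.const_mul (z ^ c)).mul_prod (hG (κ + c) (by linarith))
    refine hprod.mono' ?_ ?_
    · have h2 : Measurable fun p : ℝ × ℝ => ((z * p.2 : ℝ) : ℂ) ^ ((c : ℂ) + p.1 * Complex.I) := by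
        fun_prop
      have h3 : AEStronglyMeasurable (fun p : ℝ × ℝ => M p.1)
          (volume.prod (volume.restrict (Set.Ioi (0 : ℝ)))) := hM.aestronglyMeasurable.comp_fst
      have h4 : Measurable fun p : ℝ × ℝ => ((p.2 ^ (κ - 1) * Real.exp (-p.2) : ℝ) : ℂ) := by
        fun_prop
      exact (h2.aestronglyMeasurable.mul h3).mul h4.aestronglyMeasurable
    · have : ∀ᵐ p ∂((volume : Measure ℝ).prod (volume.restrict (Set.Ioi (0 : ℝ)))), 0 < p.2 :=
        Measure.quasiMeasurePreserving_snd.ae (p := fun x : ℝ => 0 < x)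
          ((ae_restrict_iff' measurableSet_Ioi).2 (Filter.Eventually.of_forall fun x hx => hx))
      filter_upwards [this] with p hp
      simp only [hHdef]
      rw [norm_mul, norm_mul, Complex.norm_cpow_eq_rpow_re_of_pos (by positivity),
        Complex.norm_real, Real.norm_of_nonneg (by positivity)]
      simp only [Complex.add_re, Complex.ofReal_re, Complex.mul_re, Complex.I_re, mul_zero,
        Complex.ofReal_im, Complex.I_im, sub_zero, add_zero, zero_mul]
      rw [Real.mul_rpow hz.le hp.le, show κ + c - 1 = c + (κ - 1) by ring, Real.rpow_add hp]
      exact le_of_eq (by ring)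
  have hx : ∀ t : ℝ, ∫ x in Set.Ioi (0 : ℝ), H (t, x) =
      Complex.Gamma (κ + (c + t * Complex.I)) * (z : ℂ) ^ ((c : ℂ) + t * Complex.I) * M t := by
    intro t
    rw [Complex.Gamma_eq_integral (by simp; linarith), Complex.GammaIntegral, mul_assoc,
      ← integral_mul_const]
    refine setIntegral_congr_fun measurableSet_Ioi fun x hx => ?_
    have hx0 : (x : ℂ) ≠ 0 := Complex.ofReal_ne_zero.2 (ne_of_gt hx)
    simp only [hHdef]
    rw [Complex.ofReal_mul z x, Complex.mul_cpow_ofReal_nonneg hz.le (le_of_lt hx),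
      show (κ : ℂ) + (c + t * Complex.I) - 1 = (c + t * Complex.I) + ((κ - 1 : ℝ) : ℂ) by
        push_cast; ring,
      Complex.cpow_add (c + t * Complex.I) ((κ - 1 : ℝ) : ℂ) hx0, Complex.ofReal_mul, Complex.ofReal_cpow (le_of_lt hx)]
    ring
  refine ⟨by simpa only [hx] using hH.integral_prod_left, ?_⟩
  change _ * ∫ t : ℝ, Complex.Gamma (κ + (c + t * Complex.I)) *
    (z : ℂ) ^ ((c : ℂ) + t * Complex.I) * M t = _
  simp only [← hx]
  rw [integral_integral_swap hH, ← integral_const_mul, logGammaIntegral, ← integral_complex_ofReal]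
  refine setIntegral_congr_fun measurableSet_Ioi fun x hx => ?_
  have hzx : 0 < z * x := mul_pos hz hx
  simp only [hHdef]
  rw [integral_mul_const, ← mul_assoc, ← log_one_add_eq_integral_verticalLine hc0 hc1 hzx,
    Complex.ofReal_mul (Real.log _)]

theorem meijerG1332_eq {κ z : ℝ} (hκ : 0 < κ) (hz : 0 < z) :
    meijerG1332 κ z = logGammaIntegral κ z := by
  rw [meijerG1332, (isMeijerG_logGammaIntegral hκ hz).meijerG_eq, Complex.ofReal_re]

/-! ### Logarithmic expectations under the Gamma law -/

theorem integrableOn_log_one_add_mul_gamma {κ z : ℝ} (hκ : 0 < κ) (hz : 0 < z) :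
    IntegrableOn (fun x : ℝ => Real.log (1 + z * x) * (x ^ (κ - 1) * Real.exp (-x)))
      (Set.Ioi 0) := by
  -- Since `log (1 + z x) ≤ z x`, the integrand of `z Γ(κ + 1)` dominates.
  have h := (Real.GammaIntegral_convergent (s := κ + 1) (by linarith)).const_mul z
  refine Integrable.mono' h (Measurable.aestronglyMeasurable (by fun_prop)) ?_
  refine (ae_restrict_iff' measurableSet_Ioi).2 (Filter.Eventually.of_forall fun x hx => ?_)
  have hx0 : 0 < x := hx
  have hzx : 0 < z * x := mul_pos hz hx
  have hlog := Real.log_le_sub_one_of_pos (show 0 < 1 + z * x by linarith)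
  rw [Real.norm_of_nonneg (mul_nonneg (Real.log_nonneg (by linarith)) (by positivity))]
  calc _ ≤ (z * x) * (x ^ (κ - 1) * Real.exp (-x)) := by gcongr; linarith
    _ = _ := by
      rw [add_sub_cancel_right, show κ = κ - 1 + 1 by ring, Real.rpow_add_one hx0.ne']
      ring_nf

/-- Ergodic rate `E[log₂(1 + A W)]` for a Gamma-distributed gain `W` of shape `κ` and
scale `τ`. -/
theorem integral_logb_gammaMeasure {κ τ A : ℝ} (hκ : 0 < κ) (hτ : 0 < τ) (hA : 0 < A) :
    Integrable (fun w => Real.logb 2 (1 + A * w)) (gammaMeasure κ (1 / τ)) ∧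
    ∫ w, Real.logb 2 (1 + A * w) ∂(gammaMeasure κ (1 / τ)) =
      1 / (Real.Gamma κ * Real.log 2) * meijerG1332 κ (τ * A) := by
  have hr : 0 < 1 / τ := by positivity
  have hpm : Measurable (gammaPDF κ (1 / τ)) := (measurable_gammaPDFReal _ _).ennreal_ofReal
  have hpt : ∀ᵐ x : ℝ, gammaPDF κ (1 / τ) x < ⊤ :=
    Filter.Eventually.of_forall fun x => ENNReal.ofReal_lt_top
  have htoReal : ∀ x, (gammaPDF κ (1 / τ) x).toReal = gammaPDFReal κ (1 / τ) x := fun x =>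
    ENNReal.toReal_ofReal (gammaPDFReal_nonneg hκ hr x)
  set C := 1 / (Real.Gamma κ * Real.log 2)
  set φ : ℝ → ℝ := fun x => Real.log (1 + (τ * A) * x) * (x ^ (κ - 1) * Real.exp (-x)) with hφ
  have hφi : IntegrableOn φ (Set.Ioi 0) := integrableOn_log_one_add_mul_gamma hκ (by positivity)
  -- The substitution `x ↦ τ⁻¹ x` normalises the scale and turns `A` into `τ A`. The point `0`,
  -- where the density and the indicator may differ, is null.
  have hind : (fun x => gammaPDFReal κ (1 / τ) x • Real.logb 2 (1 + A * x)) =ᵐ[volume]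
      (Set.Ioi (0 : ℝ)).indicator (fun x => C * τ⁻¹ * φ (τ⁻¹ * x)) := by
    have h0 : ∀ᵐ x : ℝ, x ≠ 0 := by simp [ae_iff, measure_singleton]
    filter_upwards [h0] with x hx0
    rcases lt_or_gt_of_ne hx0 with hx | hx
    · rw [Set.indicator_of_notMem (by simpa using hx.le), gammaPDFReal, if_neg (not_le.2 hx),
        zero_smul]
    · rw [Set.indicator_of_mem (by simpa using hx), gammaPDFReal, if_pos hx.le, smul_eq_mul]
      simp only [hφ, C]
      rw [one_div τ, Real.mul_rpow (by positivity) hx.le,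
        Real.rpow_sub_one (inv_pos.2 hτ).ne' κ,
        show τ * A * (τ⁻¹ * x) = A * x by field_simp, Real.logb]
      have := Real.Gamma_pos_of_pos hκ
      have := Real.log_pos one_lt_two
      field_simp
  have hsc : IntegrableOn (fun x => C * τ⁻¹ * φ (τ⁻¹ * x)) (Set.Ioi 0) := by
    refine Integrable.const_mul ?_ _
    have := (integrableOn_Ioi_comp_mul_left_iff φ 0 (inv_pos.2 hτ)).2 (by simpa using hφi)
    exact this
  refine ⟨?_, ?_⟩
  · rw [gammaMeasure, integrable_withDensity_iff_integrable_smul' hpm hpt]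
    simp only [htoReal]
    exact ((integrable_indicator_iff measurableSet_Ioi).2 hsc).congr hind.symm
  · rw [gammaMeasure, integral_withDensity_eq_integral_toReal_smul hpm hpt]
    simp only [htoReal]
    rw [integral_congr_ae hind, integral_indicator measurableSet_Ioi, integral_const_mul,
      integral_comp_mul_left_Ioi φ 0 (inv_pos.2 hτ), meijerG1332_eq hκ (by positivity),
      logGammaIntegral]
    simp only [mul_zero, smul_eq_mul, inv_inv, hφ]
    field_simp

/-! ### Channel gains and ergodic rates -/

theorem gainShape_pos {N : ℕ} (hN : 0 < N) : 0 < gainShape N := by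
  have h : 0 < 16 - Real.pi ^ 2 := by nlinarith [Real.pi_pos, Real.pi_lt_four]
  have : (0 : ℝ) < N := by exact_mod_cast hN
  unfold gainShape
  positivity

theorem gainScale_pos : 0 < gainScale := by
  have h : 0 < 16 - Real.pi ^ 2 := by nlinarith [Real.pi_pos, Real.pi_lt_four]
  unfold gainScale
  positivity

theorem cascadedGain_eq_equivalentGain {N : ℕ} {h g φ θ ζ : Fin N → ℝ}
    (hφ : ∀ n, φ n = θ n + ζ n) : cascadedGain h g φ θ ζ = equivalentGain h g := by
  unfold cascadedGain equivalentGain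
  have : ∀ n, φ n - θ n - ζ n = 0 := fun n => by rw [hφ]; ring
  simp only [this, Complex.ofReal_zero, mul_zero, Complex.exp_zero, mul_one]
  rw [← Complex.ofReal_sum, Complex.norm_real, Real.norm_eq_abs]

theorem HasLaw.ergodicRate_gamma {Ω : Type*} [MeasurableSpace Ω] {μ : Measure Ω} {W : Ω → ℝ}
    {κ τ A : ℝ} (hκ : 0 < κ) (hτ : 0 < τ) (hA : 0 < A)
    (hW : HasLaw W (gammaMeasure κ (1 / τ)) μ) :
    Integrable (fun ω => Real.logb 2 (1 + A * W ω)) μ ∧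
    ∫ ω, Real.logb 2 (1 + A * W ω) ∂μ =
      1 / (Real.Gamma κ * Real.log 2) * meijerG1332 κ (τ * A) := by
  obtain ⟨h1, h2⟩ := integral_logb_gammaMeasure hκ hτ hA
  rw [← hW.map_eq] at h1
  refine ⟨h1.comp_aemeasurable hW.aemeasurable, ?_⟩
  rw [← h2, ← hW.map_eq, integral_map hW.aemeasurable h1.aestronglyMeasurable]

/-- Signal plus interference carries the full power `pt + pr = 1`, so the numerator of `1 + γ_t` no
longer contains the power split; `w ≥ 0` keeps both logarithms' arguments positive. -/
theorem logb_one_add_sinrTransmit {ρ α d pr pt βt dt w : ℝ} (hρ : 0 < ρ) (hd : 0 < d)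
    (hpr : 0 < pr) (hp : pt + pr = 1) (hdt : 0 < dt) (hw : 0 ≤ w) :
    Real.logb 2 (1 + sinrTransmit ρ α d pr pt βt dt w) =
      Real.logb 2 (1 + ρ * βt ^ 2 * d ^ (-α) * dt ^ (-α) * w) -
        Real.logb 2 (1 + ρ * (pr * βt ^ 2) * d ^ (-α) * dt ^ (-α) * w) := by
  have h1 : 0 < 1 + ρ * βt ^ 2 * d ^ (-α) * dt ^ (-α) * w := by positivity
  have h2 : 0 < 1 + ρ * (pr * βt ^ 2) * d ^ (-α) * dt ^ (-α) * w := by positivity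
  rw [← Real.logb_div h1.ne' h2.ne', sinrTransmit, add_comm _ (1 : ℝ)]
  congr 1
  rw [eq_div_iff h2.ne', add_mul, div_mul_cancel₀ _ h2.ne']
  linear_combination (ρ * βt ^ 2 * d ^ (-α) * dt ^ (-α) * w) * hp

end

theorem theorem1 {Ω : Type*} [MeasurableSpace Ω] (μ : Measure Ω) [IsProbabilityMeasure μ]
    (N : ℕ) (hN : 0 < N)
    (ρ α d pr pt βr βt Rr Rt : ℝ)
    (hρ : 0 < ρ) (hd : 0 < d)
    (hpr : 0 < pr) (hpt : 0 < pt) (hp : pt + pr = 1)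
    (hβr : 0 < βr) (hβt : 0 < βt)
    -- random amplitudes and phases of the links and phase shifts of the surface
    (h gr gt φr φt θ ζr ζt : Ω → Fin N → ℝ)
    -- ideal phase shifting
    (hφr : ∀ ω n, φr ω n = θ ω n + ζr ω n)
    (hφt : ∀ ω n, φt ω n = θ ω n + ζt ω n)
    -- Gamma law (shape and rate = 1 / scale) of the equivalent channel gains
    (hWr : HasLaw (fun ω => equivalentGain (h ω) (gr ω))
      (gammaMeasure (gainShape N) (1 / gainScale)) μ)
    (hWt : HasLaw (fun ω => equivalentGain (h ω) (gt ω))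
      (gammaMeasure (gainShape N) (1 / gainScale)) μ)
    -- the SNR / SINR and the ergodic rates of the two users, as functions of the distances
    (γr γt : ℝ → Ω → ℝ) (Cr Ct : ℝ → ℝ)
    (hγr : γr = fun dr ω => snrReflect ρ α d pr βr dr
      (cascadedGain (h ω) (gr ω) (φr ω) (θ ω) (ζr ω)))
    (hγt : γt = fun dt ω => sinrTransmit ρ α d pr pt βt dt
      (cascadedGain (h ω) (gt ω) (φt ω) (θ ω) (ζt ω)))
    (hCr : Cr = fun dr => ergodicRate μ (γr dr))
    (hCt : Ct = fun dt => ergodicRate μ (γt dt)) :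
    -- the Meijer G-function occurring below is well defined and real at every `z > 0`
    (∀ z : ℝ, 0 < z → IsMeijerG 1 3 ![1 - (gainShape N : ℂ), 1, 1] ![1, 0] (z : ℂ)
      (meijerG1332 (gainShape N) z : ℂ)) ∧
    -- ergodic rate of the reflecting user
    (∀ dr : ℝ, 0 < dr → Integrable (fun ω => Real.logb 2 (1 + γr dr ω)) μ ∧
      Cr dr = reflectBound (gainShape N) gainScale ρ α d pr βr dr) ∧
    -- ergodic rate of the transmitting user
    (∀ dt : ℝ, 0 < dt → Integrable (fun ω => Real.logb 2 (1 + γt dt ω)) μ ∧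
      Ct dt = transmitBound (gainShape N) gainScale ρ α d pr βt dt) ∧
    -- coverage region, without and with its boundary
    coverageRegion Ct Cr Rt Rr =
      {x | 0 < x.1 ∧ 0 < x.2 ∧
        Rt < transmitBound (gainShape N) gainScale ρ α d pr βt x.1 ∧
        Rr < reflectBound (gainShape N) gainScale ρ α d pr βr x.2} ∧
    closedCoverageRegion Ct Cr Rt Rr =
      {x | 0 < x.1 ∧ 0 < x.2 ∧
        Rt ≤ transmitBound (gainShape N) gainScale ρ α d pr βt x.1 ∧
        Rr ≤ reflectBound (gainShape N) gainScale ρ α d pr βr x.2} := by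
  have hκ := gainShape_pos hN
  have hτ := gainScale_pos
  have hdα : 0 < d ^ α := Real.rpow_pos_of_pos hd α
  have hr : ∀ dr : ℝ, 0 < dr → Integrable (fun ω => Real.logb 2 (1 + γr dr ω)) μ ∧
      Cr dr = reflectBound (gainShape N) gainScale ρ α d pr βr dr := by
    intro dr hdr
    have hdrα : 0 < dr ^ α := Real.rpow_pos_of_pos hdr α
    obtain ⟨h1, h2⟩ := HasLaw.ergodicRate_gamma
      (A := ρ * d ^ (-α) * dr ^ (-α) * (pr * βr ^ 2)) hκ hτ (by positivity) hWr
    have e : ∀ ω, γr dr ω = ρ * d ^ (-α) * dr ^ (-α) * (pr * βr ^ 2) *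
        equivalentGain (h ω) (gr ω) := fun ω => by
      simp only [hγr, snrReflect, cascadedGain_eq_equivalentGain (hφr ω)]
    simp only [hCr, ergodicRate, e]
    refine ⟨h1, h2.trans ?_⟩
    rw [reflectBound, Real.rpow_neg hd.le, Real.rpow_neg hdr.le]
    congr 2
    field_simp
  have ht : ∀ dt : ℝ, 0 < dt → Integrable (fun ω => Real.logb 2 (1 + γt dt ω)) μ ∧
      Ct dt = transmitBound (gainShape N) gainScale ρ α d pr βt dt := by
    intro dt hdt
    have hdtα : 0 < dt ^ α := Real.rpow_pos_of_pos hdt α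
    obtain ⟨h1, h2⟩ := HasLaw.ergodicRate_gamma
      (A := ρ * βt ^ 2 * d ^ (-α) * dt ^ (-α)) hκ hτ (by positivity) hWt
    obtain ⟨h3, h4⟩ := HasLaw.ergodicRate_gamma
      (A := ρ * (pr * βt ^ 2) * d ^ (-α) * dt ^ (-α)) hκ hτ (by positivity) hWt
    have e : ∀ ω, Real.logb 2 (1 + γt dt ω) =
        Real.logb 2 (1 + ρ * βt ^ 2 * d ^ (-α) * dt ^ (-α) * equivalentGain (h ω) (gt ω)) -
          Real.logb 2 (1 + ρ * (pr * βt ^ 2) * d ^ (-α) * dt ^ (-α) *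
            equivalentGain (h ω) (gt ω)) := fun ω => by
      simp only [hγt, cascadedGain_eq_equivalentGain (hφt ω)]
      exact logb_one_add_sinrTransmit hρ hd hpr hp hdt (sq_nonneg _)
    simp only [hCt, ergodicRate, e]
    refine ⟨h1.sub h3, (integral_sub h1 h3).trans ?_⟩
    rw [h2, h4, transmitBound, Real.rpow_neg hd.le, Real.rpow_neg hdt.le]
    congr 3 <;> field_simp
  refine ⟨fun z hz => ?_, hr, ht, ?_, ?_⟩
  · rw [meijerG1332_eq hκ hz]
    exact isMeijerG_logGammaIntegral hκ hz
  · ext x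
    simp only [coverageRegion, Set.mem_ofPred_eq, gt_iff_lt]
    refine and_congr_right fun h1 => and_congr_right fun h2 => ?_
    rw [(ht _ h1).2, (hr _ h2).2]
  · ext x
    simp only [closedCoverageRegion, Set.mem_ofPred_eq]
    refine and_congr_right fun h1 => and_congr_right fun h2 => ?_
    rw [(ht _ h1).2, (hr _ h2).2]
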